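/- Let $m>0$ and consider waves in an inclined bay with parameter $m$, governed by the dimensionless shallow water equations $$\partial_t\eta+u\,\partial_x(x+\eta)+\tfrac{m}{m+1}(x+\eta)\,\partial_xu=0,\qquad \partial_tu+u\,\partial_xu+\partial_x\eta=0$$ on the wet region $x>-R(t)$, for $t$ in an interval $J\supseteq[0,\infty)$ of physical times. Here $\eta,u$ are continuously differentiable in the interior of the wet region and continuous up to the shoreline $x=-R(t)$, the total height $x+\eta$ is positive in the interior of the wet region, and $\eta=R(t)$, $u=-R'(t)$ at the shoreline. Assume that $R$ is real analytic on $\mathbb R$ and that the Carrier–Greenspan transform $$\sigma=x+\eta(x,t),\quad \tau=t-u(x,t),\quad \psi(\sigma,\tau)=\eta(x,t)+\tfrac12u(x,t)^2,\quad \varphi(\sigma,\tau)=u(x,t)$$ is invertible, i.e. the wave does not break: $(x,t)\mapsto(\sigma,\tau)$ is injective on the wet region, its Jacobian determinant does not vanish in the interior of the wet region, and at the shoreline $t\mapsto t+R'(t)$ is a bijection of $\mathbb R$. Assume moreover that $\psi,\varphi$ are defined on the whole half-plane $\sigma\ge0$, $\tau\in\mathbb R$, continuous there and continuously differentiable for $\sigma>0$;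 where the half-plane is not reached by the wave at the times in $J$, they are continued as a solution of $$\partial_\tau\psi+\tfrac{m}{m+1}\sigma\,\partial_\sigma\varphi+\varphi=0,\qquad \partial_\tau\varphi+\partial_\sigma\psi=0,$$ with the shoreline value $\psi(0,t+R'(t))=R(t)+\tfrac12R'(t)^2$ also for $t\notin J$. Write $\psi_{\rm proj}(\sigma)=\psi(\sigma,0)$ and $\varphi_{\rm proj}(\sigma)=\varphi(\sigma,0)$ for the initial pressure and the initial velocity in the hodograph plane. Then for every $\tau\in\mathbb R$ one has $\psi(0,\tau)=R(t)+\tfrac12R'(t)^2$, where $t$ is the unique solution of $t=\tau-R'(t)$; the even component in $\tau$ of $\psi(0,\tau)$ depends only on the initial pressure $\psi_{\rm proj}$, and the odd component depends only on the initial velocity $\varphi_{\rm proj}$. That is, if two such waves with the same $m$ have the same $\psi_{\rm proj}$ on $[0,\infty)$, then the even components of their shoreline pressures coincide, and if they have the same $\varphi_{\rm proj}$ on $[0,\infty)$, then the odd components coincide. -/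

import Mathlib

/-- The points `(x, t)` of the water body: `t` is a time in the interior of the set `J` of physical
times and `x` lies strictly on the wet side of the shoreline `x = -R t`. -/
def wetInterior (J : Set ℝ) (R : ℝ → ℝ) : Set (ℝ × ℝ) :=
  {p | p.2 ∈ interior J ∧ -R p.2 < p.1}

/-- The water body together with the shoreline, at all physical times. -/
def wetRegion (J : Set ℝ) (R : ℝ → ℝ) : Set (ℝ × ℝ) :=
  {p | p.2 ∈ J ∧ -R p.2 ≤ p.1}

/-- `(η, u)` is a classical solution, at the times in `J`, of the dimensionless shallow water
equations in the inclined bay with parameter `m`, and the vertical motion of its shoreline is `R`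
(the slope is `1`, so that the shoreline is at `x = -R t` and moves with velocity `-R' t`). -/
structure IsShallowWaterWave (m : ℝ) (J : Set ℝ) (R : ℝ → ℝ) (η u : ℝ → ℝ → ℝ) : Prop where
  continuousOn_displacement : ContinuousOn (fun p : ℝ × ℝ => η p.1 p.2) (wetRegion J R)
  continuousOn_velocity : ContinuousOn (fun p : ℝ × ℝ => u p.1 p.2) (wetRegion J R)
  contDiffOn_displacement : ContDiffOn ℝ 1 (fun p : ℝ × ℝ => η p.1 p.2) (wetInterior J R)
  contDiffOn_velocity : ContDiffOn ℝ 1 (fun p : ℝ × ℝ => u p.1 p.2) (wetInterior J R)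
  /-- conservation of mass -/
  mass : ∀ x t : ℝ, (x, t) ∈ wetInterior J R →
    deriv (fun s => η x s) t + u x t * deriv (fun y => y + η y t) x
      + m / (m + 1) * (x + η x t) * deriv (fun y => u y t) x = 0
  /-- conservation of momentum -/
  momentum : ∀ x t : ℝ, (x, t) ∈ wetInterior J R →
    deriv (fun s => u x s) t + u x t * deriv (fun y => u y t) x + deriv (fun y => η y t) x = 0
  /-- the total height is positive away from the shoreline -/
  height_pos : ∀ x t : ℝ, (x, t) ∈ wetInterior J R → 0 < x + η x t
  /-- `R` is the vertical position of the shoreline -/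
  shoreline_displacement : ∀ t ∈ J, η (-R t) t = R t
  /-- the shoreline moves with the water -/
  shoreline_velocity : ∀ t ∈ J, u (-R t) t = -deriv R t

/-- The Carrier-Greenspan transform of the independent variables,
`(x, t) ↦ (σ, τ) = (x + η(x,t), t - u(x,t))`. -/
def carrierGreenspan (η u : ℝ → ℝ → ℝ) (p : ℝ × ℝ) : ℝ × ℝ :=
  (p.1 + η p.1 p.2, p.2 - u p.1 p.2)

/-- The Carrier-Greenspan transform is invertible (the wave does not break). At the shoreline the
transform of time is `τ = t + R' t`; there it is required to be invertible on the whole real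
line, on which the analytic function `R` lives. -/
structure CarrierGreenspanInvertible (J : Set ℝ) (R : ℝ → ℝ) (η u : ℝ → ℝ → ℝ) : Prop where
  injOn : Set.InjOn (carrierGreenspan η u) (wetRegion J R)
  /-- the Jacobian determinant `∂(σ, τ)/∂(x, t)` does not vanish -/
  jacobian_ne_zero : ∀ x t : ℝ, (x, t) ∈ wetInterior J R →
    Matrix.det !![deriv (fun y => y + η y t) x, deriv (fun s => x + η x s) t;
                  deriv (fun y => t - u y t) x, deriv (fun s => s - u x s) t] ≠ 0
  shoreline_bijective : Function.Bijective (fun t : ℝ => t + deriv R t)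

/-- `(ψ, φ)` are the pressure and the velocity of the wave `(η, u)` in the hodograph half-plane
`{σ ≥ 0} × {τ ∈ ℝ}`. On the image of the water body under the Carrier-Greenspan transform they are
given by `ψ = η + u² / 2` and `φ = u`. Only on the remaining part of the half-plane, which the wave
does not reach during the times in `J`, is it required that they continue as a solution of the
linear hyperbolic system, and only for times outside `J` that the shoreline value of `ψ`
belongs to `R`. -/
structure IsHodographPair (m : ℝ) (J : Set ℝ) (R : ℝ → ℝ) (η u ψ φ : ℝ → ℝ → ℝ) : Prop where
  continuousOn_pressure :
    ContinuousOn (fun q : ℝ × ℝ => ψ q.1 q.2) {q : ℝ × ℝ | 0 ≤ q.1}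
  continuousOn_velocity :
    ContinuousOn (fun q : ℝ × ℝ => φ q.1 q.2) {q : ℝ × ℝ | 0 ≤ q.1}
  contDiffOn_pressure :
    ContDiffOn ℝ 1 (fun q : ℝ × ℝ => ψ q.1 q.2) {q : ℝ × ℝ | 0 < q.1}
  contDiffOn_velocity :
    ContDiffOn ℝ 1 (fun q : ℝ × ℝ => φ q.1 q.2) {q : ℝ × ℝ | 0 < q.1}
  pressure_eq : ∀ x t : ℝ, (x, t) ∈ wetRegion J R →
    ψ (x + η x t) (t - u x t) = η x t + u x t ^ 2 / 2
  velocity_eq : ∀ x t : ℝ, (x, t) ∈ wetRegion J R →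
    φ (x + η x t) (t - u x t) = u x t
  continuation_mass : ∀ σ τ : ℝ, 0 < σ →
    (σ, τ) ∉ carrierGreenspan η u '' wetInterior J R →
    deriv (fun s => ψ σ s) τ + m / (m + 1) * σ * deriv (fun s => φ s τ) σ + φ σ τ = 0
  continuation_momentum : ∀ σ τ : ℝ, 0 < σ →
    (σ, τ) ∉ carrierGreenspan η u '' wetInterior J R →
    deriv (fun s => φ σ s) τ + deriv (fun s => ψ s τ) σ = 0
  continuation_shoreline : ∀ t : ℝ, t ∉ J →
    ψ 0 (t + deriv R t) = R t + deriv R t ^ 2 / 2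

/-- A wave that does not break, with an analytic shoreline motion `R`, physical displacement `η`
and velocity `u` at the times in the interval `J` (which contains the initial time `0` and
all later times), and hodograph pressure `ψ` and velocity `φ`. -/
structure IsNonbreakingWave (m : ℝ) (J : Set ℝ) (R : ℝ → ℝ) (η u ψ φ : ℝ → ℝ → ℝ) : Prop where
  ordConnected : J.OrdConnected
  nonneg_subset : Set.Ici 0 ⊆ J
  analytic : AnalyticOnNhd ℝ R Set.univ
  wave : IsShallowWaterWave m J R η u
  invertible : CarrierGreenspanInvertible J R η u
  hodograph : IsHodographPair m J R η u ψ φ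

/-- The initial pressure `ψ_proj`, on the line `τ = 0`. -/
def initialPressure (ψ : ℝ → ℝ → ℝ) (σ : ℝ) : ℝ := ψ σ 0

/-- The initial velocity `φ_proj`, on the line `τ = 0`. -/
def initialVelocity (φ : ℝ → ℝ → ℝ) (σ : ℝ) : ℝ := φ σ 0

/-- The time `t` with `t = τ - R' t` (meaningful when `t ↦ t + R' t` is bijective). -/
noncomputable def shorelineTime (R : ℝ → ℝ) (τ : ℝ) : ℝ :=
  Function.invFun (fun t : ℝ => t + deriv R t) τ

/-- The pressure at the shoreline, `R t + (R' t)² / 2` with `t = τ - R' t`. -/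
noncomputable def shorelinePressure (R : ℝ → ℝ) (τ : ℝ) : ℝ :=
  R (shorelineTime R τ) + deriv R (shorelineTime R τ) ^ 2 / 2

/-- The even component of a function on the real line. -/
noncomputable def evenComponent (f : ℝ → ℝ) (τ : ℝ) : ℝ := (f τ + f (-τ)) / 2

/-- The odd component of a function on the real line. -/
noncomputable def oddComponent (f : ℝ → ℝ) (τ : ℝ) : ℝ := (f τ - f (-τ)) / 2

/-! The chain rule and the nonzero Jacobian turn the shallow water equations into the linear
hodograph system on the image of the water body; elsewhere that system is assumed. So the difference
of two waves solves it with `k = c ^ 2 = m / (m + 1)`.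

The system is invariant under `(τ, P, V) ↦ (-τ, P, -V)`. If the initial pressure vanishes, `P(σ, τ)
+ P(σ, -τ)` is the pressure of a solution with zero initial data; if the initial velocity vanishes,
`P(σ, τ) - P(σ, -τ)` is. Everything thus reduces to uniqueness at the shoreline
(`pressure_eq_zero`), which `energyDivergence` yields through a weighted energy estimate with a
cutoff along incoming characteristics. The weight `σ ^ (1 / c ^ 2 - 1)`, that is `σ ^ (1 / m)`, puts
the energy balance in divergence form, and the flux vanishes at `σ = 0`. -/

/-- `(P, V)` is a classical solution, continuous up to `σ = 0`, of the linear hodograph system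
`∂_τ P + k σ ∂_σ V + V = 0`, `∂_τ V + ∂_σ P = 0` on the half-plane `σ > 0`. -/
structure IsHodographSolution (k : ℝ) (P V : ℝ × ℝ → ℝ) : Prop where
  continuousOn_pressure : ContinuousOn P {q | 0 ≤ q.1}
  continuousOn_velocity : ContinuousOn V {q | 0 ≤ q.1}
  differentiableAt_pressure : ∀ q : ℝ × ℝ, 0 < q.1 → DifferentiableAt ℝ P q
  differentiableAt_velocity : ∀ q : ℝ × ℝ, 0 < q.1 → DifferentiableAt ℝ V q
  mass : ∀ q : ℝ × ℝ, 0 < q.1 →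
    fderiv ℝ P q (0, 1) + k * q.1 * fderiv ℝ V q (1, 0) + V q = 0
  momentum : ∀ q : ℝ × ℝ, 0 < q.1 → fderiv ℝ V q (0, 1) + fderiv ℝ P q (1, 0) = 0

/-! ### Symmetries of the linear system -/

namespace IsHodographSolution

theorem sub {k : ℝ} {P₁ V₁ P₂ V₂ : ℝ × ℝ → ℝ} (h₁ : IsHodographSolution k P₁ V₁)
    (h₂ : IsHodographSolution k P₂ V₂) :
    IsHodographSolution k (fun q => P₁ q - P₂ q) (fun q => V₁ q - V₂ q) where
  continuousOn_pressure := h₁.continuousOn_pressure.sub h₂.continuousOn_pressure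
  continuousOn_velocity := h₁.continuousOn_velocity.sub h₂.continuousOn_velocity
  differentiableAt_pressure q hq :=
    (h₁.differentiableAt_pressure q hq).sub (h₂.differentiableAt_pressure q hq)
  differentiableAt_velocity q hq :=
    (h₁.differentiableAt_velocity q hq).sub (h₂.differentiableAt_velocity q hq)
  mass q hq := by
    rw [fderiv_fun_sub (h₁.differentiableAt_pressure q hq) (h₂.differentiableAt_pressure q hq),
      fderiv_fun_sub (h₁.differentiableAt_velocity q hq) (h₂.differentiableAt_velocity q hq)]
    simp only [sub_apply]
    linear_combination h₁.mass q hq - h₂.mass q hq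
  momentum q hq := by
    rw [fderiv_fun_sub (h₁.differentiableAt_pressure q hq) (h₂.differentiableAt_pressure q hq),
      fderiv_fun_sub (h₁.differentiableAt_velocity q hq) (h₂.differentiableAt_velocity q hq)]
    simp only [sub_apply]
    linear_combination h₁.momentum q hq - h₂.momentum q hq

theorem neg {k : ℝ} {P V : ℝ × ℝ → ℝ} (h : IsHodographSolution k P V) :
    IsHodographSolution k (fun q => -P q) (fun q => -V q) where
  continuousOn_pressure := h.continuousOn_pressure.neg
  continuousOn_velocity := h.continuousOn_velocity.neg
  differentiableAt_pressure q hq := (h.differentiableAt_pressure q hq).neg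
  differentiableAt_velocity q hq := (h.differentiableAt_velocity q hq).neg
  mass q hq := by
    rw [fderiv_fun_neg, fderiv_fun_neg]
    simp only [neg_apply]
    linear_combination -h.mass q hq
  momentum q hq := by
    rw [fderiv_fun_neg, fderiv_fun_neg]
    simp only [neg_apply]
    linear_combination -h.momentum q hq

/-- Time reversal: every term of the mass equation changes sign, while both terms of the momentum
equation are preserved. -/
theorem reflect {k : ℝ} {P V : ℝ × ℝ → ℝ} (h : IsHodographSolution k P V) :
    IsHodographSolution k (fun q => P (q.1, -q.2)) (fun q => -V (q.1, -q.2)) := by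
  have hr : ∀ q : ℝ × ℝ, HasFDerivAt (fun q : ℝ × ℝ => (q.1, -q.2))
      ((ContinuousLinearMap.fst ℝ ℝ ℝ).prod (-ContinuousLinearMap.snd ℝ ℝ ℝ)) q :=
    fun q => hasFDerivAt_fst.prodMk hasFDerivAt_snd.neg
  have hc : Continuous (fun q : ℝ × ℝ => (q.1, -q.2)) := by fun_prop
  have hP : ∀ q : ℝ × ℝ, 0 < q.1 → HasFDerivAt (fun q : ℝ × ℝ => P (q.1, -q.2))
      ((fderiv ℝ P (q.1, -q.2)).comp
        ((ContinuousLinearMap.fst ℝ ℝ ℝ).prod (-ContinuousLinearMap.snd ℝ ℝ ℝ))) q :=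
    fun q hq => (h.differentiableAt_pressure (q.1, -q.2) hq).hasFDerivAt.comp q (hr q)
  have hV : ∀ q : ℝ × ℝ, 0 < q.1 → HasFDerivAt (fun q : ℝ × ℝ => -V (q.1, -q.2))
      (-(fderiv ℝ V (q.1, -q.2)).comp
        ((ContinuousLinearMap.fst ℝ ℝ ℝ).prod (-ContinuousLinearMap.snd ℝ ℝ ℝ))) q :=
    fun q hq => ((h.differentiableAt_velocity (q.1, -q.2) hq).hasFDerivAt.comp q (hr q)).neg
  have hneg : ∀ L : ℝ × ℝ →L[ℝ] ℝ, L (0, -1) = -L (0, 1) := fun L => by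
    rw [← map_neg]; simp
  refine ⟨h.continuousOn_pressure.comp hc.continuousOn fun q hq => hq,
    (h.continuousOn_velocity.comp hc.continuousOn fun q hq => hq).neg,
    fun q hq => (hP q hq).differentiableAt, fun q hq => (hV q hq).differentiableAt,
    fun q hq => ?_, fun q hq => ?_⟩
  · rw [(hP q hq).fderiv, (hV q hq).fderiv]
    have := h.mass (q.1, -q.2) hq
    simp [hneg] at this ⊢
    linear_combination -this
  · rw [(hP q hq).fderiv, (hV q hq).fderiv]
    have := h.momentum (q.1, -q.2) hq
    simp [hneg] at this ⊢
    linear_combination this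

end IsHodographSolution

/-! ### Weighted energy estimate and uniqueness at the shoreline -/

/-- The divergence theorem on a rectangle, for a vector field whose divergence extends
continuously to the boundary. -/
theorem setIntegral_divergence_eq_of_continuousOn {f g d : ℝ × ℝ → ℝ} {a b : ℝ × ℝ} (hab : a ≤ b)
    (hf : ContinuousOn f (Set.Icc a b)) (hg : ContinuousOn g (Set.Icc a b))
    (hd : ContinuousOn d (Set.Icc a b))
    (hdf : ∀ q ∈ Set.Ioo a.1 b.1 ×ˢ Set.Ioo a.2 b.2, DifferentiableAt ℝ f q)
    (hdg : ∀ q ∈ Set.Ioo a.1 b.1 ×ˢ Set.Ioo a.2 b.2, DifferentiableAt ℝ g q)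
    (hdiv : ∀ q ∈ Set.Ioo a.1 b.1 ×ˢ Set.Ioo a.2 b.2,
      fderiv ℝ f q (1, 0) + fderiv ℝ g q (0, 1) = d q) :
    ∫ q in Set.Icc a b, d q =
      (((∫ x in a.1..b.1, g (x, b.2)) - ∫ x in a.1..b.1, g (x, a.2)) +
        ∫ y in a.2..b.2, f (b.1, y)) - ∫ y in a.2..b.2, f (a.1, y) := by
  classical
  -- Off the open rectangle the derivatives are junk values, chosen so that the divergence equals
  -- `d` everywhere; integrability then follows from continuity of `d`.
  let f' : ℝ × ℝ → ℝ × ℝ →L[ℝ] ℝ := fun q =>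
    if q ∈ Set.Ioo a.1 b.1 ×ˢ Set.Ioo a.2 b.2 then fderiv ℝ f q
    else d q • ContinuousLinearMap.fst ℝ ℝ ℝ
  let g' : ℝ × ℝ → ℝ × ℝ →L[ℝ] ℝ := fun q =>
    if q ∈ Set.Ioo a.1 b.1 ×ˢ Set.Ioo a.2 b.2 then fderiv ℝ g q else 0
  have heq : (fun q => f' q (1, 0) + g' q (0, 1)) = d := by
    funext q
    by_cases hq : q ∈ Set.Ioo a.1 b.1 ×ˢ Set.Ioo a.2 b.2
    · simp only [f', g', if_pos hq, hdiv q hq]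
    · simp only [f', g', if_neg hq]
      simp
  have h := MeasureTheory.integral_divergence_prod_Icc_of_hasFDerivAt_of_le f g f' g' a b hab hf hg
    (fun q hq => by simpa only [f', if_pos hq] using (hdf q hq).hasFDerivAt)
    (fun q hq => by simpa only [g', if_pos hq] using (hdg q hq).hasFDerivAt)
    (by rw [heq]; exact hd.integrableOn_compact isCompact_Icc)
  rwa [heq] at h

/-- Squaring removes the corner of the positive part, so the squared cutoff is differentiable across
the characteristic where it vanishes. -/
theorem hasDerivAt_max_zero_sq (x : ℝ) : HasDerivAt (fun y : ℝ => max 0 y ^ 2) (2 * max 0 x) x := by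
  rcases lt_trichotomy x 0 with hx | rfl | hx
  · rw [max_eq_left hx.le, mul_zero]
    refine (hasDerivAt_const x (0 : ℝ)).congr_of_eventuallyEq ?_
    filter_upwards [Iio_mem_nhds hx] with y hy
    simp [max_eq_left (Set.mem_Iio.1 hy).le]
  · rw [hasDerivAt_iff_isLittleO_nhds_zero]
    refine Asymptotics.IsBigO.trans_isLittleO ?_
      (Asymptotics.isLittleO_pow_id (𝕜 := ℝ) one_lt_two)
    refine Asymptotics.IsBigO.of_bound 1 (Filter.Eventually.of_forall fun y => ?_)
    rcases le_total y 0 with hy | hy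
    · simp [max_eq_left hy, sq_nonneg]
    · simp [max_eq_right hy]
  · rw [max_eq_right hx.le]
    have h : HasDerivAt (fun y : ℝ => y ^ 2) (2 * x) x := by simpa using hasDerivAt_pow 2 x
    refine h.congr_of_eventuallyEq ?_
    filter_upwards [Ioi_mem_nhds hx] with y hy
    simp [max_eq_right (Set.mem_Ioi.1 hy).le]

/-- A cutoff that is constant along the incoming characteristics `τ + 2 √σ / c = const`. -/
noncomputable def characteristicCutoff (c A : ℝ) (q : ℝ × ℝ) : ℝ :=
  max 0 (A - q.2 - 2 * √q.1 / c)

theorem continuous_characteristicCutoff (c A : ℝ) : Continuous (characteristicCutoff c A) := by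
  unfold characteristicCutoff
  fun_prop

theorem hasFDerivAt_characteristicCutoff_sq {c : ℝ} (A : ℝ) {q : ℝ × ℝ} (hq : 0 < q.1) :
    HasFDerivAt (fun q => characteristicCutoff c A q ^ 2)
      ((2 * characteristicCutoff c A q) •
        (-ContinuousLinearMap.snd ℝ ℝ ℝ - (1 / (c * √q.1)) • ContinuousLinearMap.fst ℝ ℝ ℝ)) q := by
  have h1 : HasFDerivAt (fun q : ℝ × ℝ => A - q.2 - 2 * √q.1 / c)
      (-ContinuousLinearMap.snd ℝ ℝ ℝ - (1 / (c * √q.1)) • ContinuousLinearMap.fst ℝ ℝ ℝ) q := by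
    have hs : HasFDerivAt (fun q : ℝ × ℝ => √q.1)
        ((1 / (2 * √q.1)) • ContinuousLinearMap.fst ℝ ℝ ℝ) q :=
      hasFDerivAt_fst.sqrt hq.ne'
    have h := ((hasFDerivAt_snd (𝕜 := ℝ) (p := q)).const_sub A).fun_sub (hs.const_mul (2 / c))
    rw [smul_smul, show 2 / c * (1 / (2 * √q.1)) = 1 / (c * √q.1) by ring] at h
    exact h.congr_of_eventuallyEq (Filter.Eventually.of_forall fun p => by ring)
  exact (hasDerivAt_max_zero_sq _).comp_hasFDerivAt q h1

namespace IsHodographSolution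

variable {c : ℝ} {P V : ℝ × ℝ → ℝ}

/-- The energy flux `c² σ ^ (b + 1) P V`, `b = 1 / c² - 1`, with the cutoff. -/
noncomputable def energyFlux (c A : ℝ) (P V : ℝ × ℝ → ℝ) (q : ℝ × ℝ) : ℝ :=
  q.1 ^ (1 / c ^ 2 - 1) * (c ^ 2 * q.1 * (P q * V q)) * characteristicCutoff c A q ^ 2

/-- The energy density `σ ^ b (P² + c² σ V²) / 2`, `b = 1 / c² - 1`, with the cutoff. -/
noncomputable def energyDensity (c A : ℝ) (P V : ℝ × ℝ → ℝ) (q : ℝ × ℝ) : ℝ :=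
  q.1 ^ (1 / c ^ 2 - 1) * ((P q ^ 2 + c ^ 2 * q.1 * V q ^ 2) / 2) * characteristicCutoff c A q ^ 2

/-- Without the cutoff the divergence is zero, because `c ^ 2 * (b + 1) = 1` cancels the term `P V`
coming from the mass equation. Differentiating the cutoff along its characteristics completes a
square with a negative sign. -/
theorem energyDivergence (hc : 0 < c) (A : ℝ) (h : IsHodographSolution (c ^ 2) P V) {q : ℝ × ℝ}
    (hq : 0 < q.1) :
    DifferentiableAt ℝ (energyFlux c A P V) q ∧ DifferentiableAt ℝ (energyDensity c A P V) q ∧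
      fderiv ℝ (energyFlux c A P V) q (1, 0) + fderiv ℝ (energyDensity c A P V) q (0, 1) =
        -(characteristicCutoff c A q *
          (q.1 ^ (1 / c ^ 2 - 1) * (P q + c * √q.1 * V q) ^ 2)) := by
  have hP := (h.differentiableAt_pressure q hq).hasFDerivAt
  have hV := (h.differentiableAt_velocity q hq).hasFDerivAt
  have hw := hasFDerivAt_characteristicCutoff_sq (c := c) A hq
  have hσ : HasFDerivAt (fun q : ℝ × ℝ => q.1) (ContinuousLinearMap.fst ℝ ℝ ℝ) q := hasFDerivAt_fst
  have hr : HasFDerivAt (fun q : ℝ × ℝ => q.1 ^ (1 / c ^ 2 - 1))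
      (((1 / c ^ 2 - 1) * (q.1 ^ (1 / c ^ 2 - 1) / q.1)) • ContinuousLinearMap.fst ℝ ℝ ℝ) q := by
    rw [← Real.rpow_sub_one hq.ne']
    exact (Real.hasDerivAt_rpow_const (Or.inl hq.ne')).comp_hasFDerivAt q hσ
  have hF := (hr.mul ((hσ.const_mul (c ^ 2)).mul (hP.mul hV))).mul hw
  have hG := (hr.mul (((hP.pow 2).add ((hσ.const_mul (c ^ 2)).mul (hV.pow 2))).mul_const
    (1 / 2 : ℝ))).mul hw
  have hF' : HasFDerivAt (energyFlux c A P V) _ q := hF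
  have hG' : HasFDerivAt (energyDensity c A P V) _ q :=
    hG.congr_of_eventuallyEq (Filter.Eventually.of_forall fun p => by
      simp only [energyDensity, Pi.mul_apply, Pi.add_apply]; ring)
  refine ⟨hF'.differentiableAt, hG'.differentiableAt, ?_⟩
  rw [hF'.fderiv, hG'.fderiv]
  have h1 := h.mass q hq
  have h2 := h.momentum q hq
  have hs : 0 < √q.1 := Real.sqrt_pos.2 hq
  have hsq : q.1 = √q.1 ^ 2 := (Real.sq_sqrt hq.le).symm
  simp
  -- The weight's derivative is already a multiple of the weight over `σ`, so weight and cutoff can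
  -- be free symbols; only `σ = s ^ 2` is still needed.
  generalize q.1 ^ ((c ^ 2)⁻¹ - 1) = r
  generalize characteristicCutoff c A q = w
  generalize √q.1 = s at *
  rw [hsq] at h1 ⊢
  have e1 : fderiv ℝ P q (0, 1) = -(c ^ 2 * s ^ 2 * fderiv ℝ V q (1, 0) + V q) := by
    linear_combination h1
  have e2 : fderiv ℝ V q (0, 1) = -fderiv ℝ P q (1, 0) := by linear_combination h2
  rw [e1, e2]
  field_simp
  ring

theorem pressure_eq_zero_of_pos (hc : 0 < c) (hc1 : c < 1) (h : IsHodographSolution (c ^ 2) P V)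
    (hP0 : ∀ σ, 0 ≤ σ → P (σ, 0) = 0) (hV0 : ∀ σ, 0 ≤ σ → V (σ, 0) = 0) {T : ℝ} (hT : 0 < T) :
    P (0, T) = 0 := by
  -- The cutoff equals `1` at `(0, T)`, and `M` is where its support meets `τ = 0`, so it vanishes
  -- on the side `σ = M`.
  set A : ℝ := T + 1 with hA
  set M : ℝ := (c * A / 2) ^ 2 with hM
  have hApos : 0 < A := by positivity
  have hMpos : 0 < M := by positivity
  have hsM : √M = c * A / 2 := Real.sqrt_sq (by positivity)
  -- Here `c < 1` enters: the weight is continuous up to `σ = 0`.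
  have hb : 0 < 1 / c ^ 2 - 1 := by
    rw [sub_pos, lt_div_iff₀ (by positivity)]
    nlinarith
  have hab : ((0, 0) : ℝ × ℝ) ≤ (M, T) := ⟨hMpos.le, hT.le⟩
  have hsub : Set.Icc ((0, 0) : ℝ × ℝ) (M, T) ⊆ {q | 0 ≤ q.1} := fun q hq => hq.1.1
  have hPc := h.continuousOn_pressure.mono hsub
  have hVc := h.continuousOn_velocity.mono hsub
  have hwc := (continuous_characteristicCutoff c A).continuousOn (s := Set.Icc (0, 0) (M, T))
  have hrc : ContinuousOn (fun q : ℝ × ℝ => q.1 ^ (1 / c ^ 2 - 1)) (Set.Icc (0, 0) (M, T)) :=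
    (continuous_fst.rpow_const fun q => Or.inr hb.le).continuousOn
  have hFc : ContinuousOn (energyFlux c A P V) (Set.Icc (0, 0) (M, T)) := by
    unfold energyFlux; fun_prop
  have hGc : ContinuousOn (energyDensity c A P V) (Set.Icc (0, 0) (M, T)) := by
    unfold energyDensity; fun_prop
  have key := setIntegral_divergence_eq_of_continuousOn (d := fun q =>
      -(characteristicCutoff c A q * (q.1 ^ (1 / c ^ 2 - 1) * (P q + c * √q.1 * V q) ^ 2)))
    hab hFc hGc (by fun_prop)
    (fun q hq => (h.energyDivergence hc A hq.1.1).1)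
    (fun q hq => (h.energyDivergence hc A hq.1.1).2.1)
    (fun q hq => (h.energyDivergence hc A hq.1.1).2.2)
  have hneg : ∫ q in Set.Icc ((0, 0) : ℝ × ℝ) (M, T),
      -(characteristicCutoff c A q * (q.1 ^ (1 / c ^ 2 - 1) * (P q + c * √q.1 * V q) ^ 2)) ≤ 0 := by
    refine MeasureTheory.setIntegral_nonpos measurableSet_Icc fun q hq => ?_
    have := Real.rpow_nonneg (hsub hq) (1 / c ^ 2 - 1)
    have hw : 0 ≤ characteristicCutoff c A q := le_max_left _ _
    exact neg_nonpos.2 (by positivity)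
  have hG0 : ∫ x in (0 : ℝ)..M, energyDensity c A P V (x, 0) = 0 := by
    rw [intervalIntegral.integral_congr (g := fun _ => (0 : ℝ)), intervalIntegral.integral_zero]
    intro x hx
    rw [Set.uIcc_of_le hMpos.le] at hx
    simp [energyDensity, hP0 x hx.1, hV0 x hx.1]
  have hF0 : ∫ y in (0 : ℝ)..T, energyFlux c A P V (0, y) = 0 := by
    simp [energyFlux]
  have hFM : ∫ y in (0 : ℝ)..T, energyFlux c A P V (M, y) = 0 := by
    rw [intervalIntegral.integral_congr (g := fun _ => (0 : ℝ)), intervalIntegral.integral_zero]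
    intro y hy
    rw [Set.uIcc_of_le hT.le] at hy
    have : characteristicCutoff c A (M, y) = 0 := by
      refine max_eq_left ?_
      have : 2 * √M / c = A := by rw [hsM]; field_simp
      simp only [this]
      linarith [hy.1]
    simp [energyFlux, this]
  simp only [hG0, hF0, hFM] at key
  have hle : ∫ x in (0 : ℝ)..M, energyDensity c A P V (x, T) ≤ 0 := by linarith
  have hzero : ∀ x ∈ Set.Icc 0 M, energyDensity c A P V (x, T) ≤ 0 := by
    by_contra! hcon
    refine hle.not_gt (intervalIntegral.integral_pos hMpos ?_ ?_ hcon)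
    · exact hGc.comp (by fun_prop) fun x hx => ⟨⟨hx.1, hT.le⟩, ⟨hx.2, le_rfl⟩⟩
    · intro x hx
      have := Real.rpow_nonneg hx.1.le (1 / c ^ 2 - 1)
      have := hx.1.le
      simp only [energyDensity]
      positivity
  -- The weight vanishes at `σ = 0`, so zero energy gives `P = 0` only for small `σ > 0`; the
  -- shoreline value follows by continuity.
  have hev : ∀ᶠ x in nhdsWithin (0 : ℝ) (Set.Ioi 0), P (x, T) = 0 := by
    have hx1 : ∀ᶠ x in nhdsWithin (0 : ℝ) (Set.Ioi 0), x < M :=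
      mem_nhdsWithin_of_mem_nhds (Iio_mem_nhds hMpos)
    have hx2 : ∀ᶠ x in nhdsWithin (0 : ℝ) (Set.Ioi 0), 0 < characteristicCutoff c A (x, T) := by
      have hcont : Continuous fun x : ℝ => characteristicCutoff c A (x, T) :=
        (continuous_characteristicCutoff c A).comp (by fun_prop)
      refine mem_nhdsWithin_of_mem_nhds (hcont.continuousAt.eventually_const_lt ?_)
      simp [characteristicCutoff, hA]
    filter_upwards [hx1, hx2, self_mem_nhdsWithin] with x hxM hw hx0
    have hx0 : 0 < x := hx0
    have hz := hzero x ⟨hx0.le, hxM.le⟩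
    by_contra hne
    have := Real.rpow_pos_of_pos hx0 (1 / c ^ 2 - 1)
    refine hz.not_gt ?_
    simp only [energyDensity]
    positivity
  have hlim : Filter.Tendsto (fun x : ℝ => P (x, T)) (nhdsWithin 0 (Set.Ioi 0)) (nhds (P (0, T))) := by
    have hcw : ContinuousOn (fun x : ℝ => P (x, T)) (Set.Ici 0) :=
      h.continuousOn_pressure.comp (by fun_prop) fun x hx => hx
    exact (hcw 0 Set.self_mem_Ici).mono_left (nhdsWithin_mono _ Set.Ioi_subset_Ici_self)
  exact tendsto_nhds_unique (hlim.congr' hev) tendsto_const_nhds |>.symm ▸ rfl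

theorem pressure_eq_zero (hc : 0 < c) (hc1 : c < 1) (h : IsHodographSolution (c ^ 2) P V)
    (hP0 : ∀ σ, 0 ≤ σ → P (σ, 0) = 0) (hV0 : ∀ σ, 0 ≤ σ → V (σ, 0) = 0) (τ : ℝ) :
    P (0, τ) = 0 := by
  rcases lt_trichotomy τ 0 with hτ | rfl | hτ
  · simpa using h.reflect.pressure_eq_zero_of_pos hc hc1 (by simpa using hP0) (by simpa using hV0)
      (neg_pos.2 hτ)
  · exact hP0 0 le_rfl
  · exact h.pressure_eq_zero_of_pos hc hc1 hP0 hV0 hτ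

/-- A solution with vanishing initial pressure has an odd pressure at the shoreline. -/
theorem pressure_add_neg_eq_zero (hc : 0 < c) (hc1 : c < 1) (h : IsHodographSolution (c ^ 2) P V)
    (hP0 : ∀ σ, 0 ≤ σ → P (σ, 0) = 0) (τ : ℝ) : P (0, τ) + P (0, -τ) = 0 := by
  -- The velocity of this combination is `V(σ, τ) - V(σ, -τ)`, which is zero at `τ = 0` for free.
  have := (h.sub h.reflect.neg).pressure_eq_zero hc hc1 (by simp +contextual [hP0])
    (by simp) τ
  simpa using this

/-- A solution with vanishing initial velocity has an even pressure at the shoreline. -/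
theorem pressure_sub_neg_eq_zero (hc : 0 < c) (hc1 : c < 1) (h : IsHodographSolution (c ^ 2) P V)
    (hV0 : ∀ σ, 0 ≤ σ → V (σ, 0) = 0) (τ : ℝ) : P (0, τ) - P (0, -τ) = 0 :=
  (h.sub h.reflect).pressure_eq_zero hc hc1 (by simp) (by simp +contextual [hV0]) τ

end IsHodographSolution

/-! ### From the shallow water equations to the hodograph system -/

theorem isOpen_wetInterior {J : Set ℝ} {R : ℝ → ℝ} (hR : Continuous R) :
    IsOpen (wetInterior J R) :=
  (isOpen_interior.preimage continuous_snd).inter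
    (isOpen_lt ((hR.comp continuous_snd).neg) continuous_fst)

theorem HasFDerivAt.hasDerivAt_mk_left {f : ℝ × ℝ → ℝ} {L : ℝ × ℝ →L[ℝ] ℝ} {x t : ℝ}
    (h : HasFDerivAt f L (x, t)) : HasDerivAt (fun y => f (y, t)) (L (1, 0)) x :=
  h.comp_hasDerivAt x ((hasDerivAt_id' x).prodMk (hasDerivAt_const x t))

theorem HasFDerivAt.hasDerivAt_mk_right {f : ℝ × ℝ → ℝ} {L : ℝ × ℝ →L[ℝ] ℝ} {x t : ℝ}
    (h : HasFDerivAt f L (x, t)) : HasDerivAt (fun s => f (x, s)) (L (0, 1)) t :=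
  h.comp_hasDerivAt t ((hasDerivAt_const t x).prodMk (hasDerivAt_id' t))

/-- Cramer's rule: the last four hypotheses are the chain rule for `φ = u` and `ψ = η + u ^ 2 / 2`.
After multiplication by the Jacobian `d`, mass gives mass and momentum gives momentum. -/
theorem hodograph_system_of_shallow_water {k σ d ηx ηt ux ut u Px Pt Vx Vt : ℝ}
    (hd : d = (1 + ηx) * (1 - ut) + ηt * ux) (hd0 : d ≠ 0)
    (hmass : ηt + u * (1 + ηx) + k * σ * ux = 0) (hmom : ut + u * ux + ηx = 0)
    (hVx : Vx * (1 + ηx) - Vt * ux = ux) (hVt : Vx * ηt + Vt * (1 - ut) = ut)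
    (hPx : Px * (1 + ηx) - Pt * ux = ηx + u * ux)
    (hPt : Px * ηt + Pt * (1 - ut) = ηt + u * ut) :
    Pt + k * σ * Vx + u = 0 ∧ Vt + Px = 0 := by
  have eVx : d * Vx = ux := by linear_combination Vx * hd + (1 - ut) * hVx + ux * hVt
  have eVt : d * Vt = (1 + ηx) * ut - ηt * ux := by
    linear_combination Vt * hd + (1 + ηx) * hVt - ηt * hVx
  have ePx : d * Px = (ηx + u * ux) * (1 - ut) + ux * (ηt + u * ut) := by
    linear_combination Px * hd + (1 - ut) * hPx + ux * hPt
  have ePt : d * Pt = (1 + ηx) * (ηt + u * ut) - ηt * (ηx + u * ux) := by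
    linear_combination Pt * hd + (1 + ηx) * hPt - ηt * hPx
  constructor <;> refine (mul_eq_zero.1 ?_).resolve_left hd0
  · linear_combination ePt + k * σ * eVx + u * hd + hmass
  · linear_combination eVt + ePx + hmom

namespace IsNonbreakingWave

variable {m : ℝ} {J : Set ℝ} {R : ℝ → ℝ} {η u ψ φ : ℝ → ℝ → ℝ}

theorem hodograph_system_of_mem_image (h : IsNonbreakingWave m J R η u ψ φ) {x t : ℝ}
    (hp : (x, t) ∈ wetInterior J R) {q : ℝ × ℝ} (hq : carrierGreenspan η u (x, t) = q)
    (hP : DifferentiableAt ℝ (fun q : ℝ × ℝ => ψ q.1 q.2) q)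
    (hV : DifferentiableAt ℝ (fun q : ℝ × ℝ => φ q.1 q.2) q) :
    fderiv ℝ (fun q : ℝ × ℝ => ψ q.1 q.2) q (0, 1)
        + m / (m + 1) * q.1 * fderiv ℝ (fun q : ℝ × ℝ => φ q.1 q.2) q (1, 0) + φ q.1 q.2 = 0 ∧
      fderiv ℝ (fun q : ℝ × ℝ => φ q.1 q.2) q (0, 1)
        + fderiv ℝ (fun q : ℝ × ℝ => ψ q.1 q.2) q (1, 0) = 0 := by
  subst hq
  have hR : Continuous R :=
    continuous_iff_continuousAt.2 fun t => (h.analytic t (Set.mem_univ t)).continuousAt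
  have hnhds := (isOpen_wetInterior (J := J) hR).mem_nhds hp
  have hsub : wetInterior J R ⊆ wetRegion J R := fun p hp => ⟨interior_subset hp.1, hp.2.le⟩
  have hη : DifferentiableAt ℝ (fun p : ℝ × ℝ => η p.1 p.2) (x, t) :=
    (h.wave.contDiffOn_displacement.contDiffAt hnhds).differentiableAt one_ne_zero
  have hu : DifferentiableAt ℝ (fun p : ℝ × ℝ => u p.1 p.2) (x, t) :=
    (h.wave.contDiffOn_velocity.contDiffAt hnhds).differentiableAt one_ne_zero
  have hη' := hη.hasFDerivAt
  have hu' := hu.hasFDerivAt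
  have hηx : HasDerivAt (fun y => η y t) (fderiv ℝ (fun p : ℝ × ℝ => η p.1 p.2) (x, t) (1, 0)) x :=
    hη'.hasDerivAt_mk_left
  have hηt : HasDerivAt (fun s => η x s) (fderiv ℝ (fun p : ℝ × ℝ => η p.1 p.2) (x, t) (0, 1)) t :=
    hη'.hasDerivAt_mk_right
  have hux : HasDerivAt (fun y => u y t) (fderiv ℝ (fun p : ℝ × ℝ => u p.1 p.2) (x, t) (1, 0)) x :=
    hu'.hasDerivAt_mk_left
  have hut : HasDerivAt (fun s => u x s) (fderiv ℝ (fun p : ℝ × ℝ => u p.1 p.2) (x, t) (0, 1)) t :=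
    hu'.hasDerivAt_mk_right
  have hCG : HasFDerivAt (carrierGreenspan η u)
      ((ContinuousLinearMap.fst ℝ ℝ ℝ + fderiv ℝ (fun p : ℝ × ℝ => η p.1 p.2) (x, t)).prod
        (ContinuousLinearMap.snd ℝ ℝ ℝ - fderiv ℝ (fun p : ℝ × ℝ => u p.1 p.2) (x, t))) (x, t) :=
    (hasFDerivAt_fst.add hη').prodMk (hasFDerivAt_snd.sub hu')
  -- The defining relation holds on a neighbourhood of `(x, t)`, so the two derivatives of `ψ`
  -- composed with the transform agree.
  have hPeq := (hP.hasFDerivAt.comp (x, t) hCG).unique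
    ((hη'.add ((hu'.pow 2).mul_const (1 / 2 : ℝ))).congr_of_eventuallyEq (by
      filter_upwards [hnhds] with p hp
      have := h.hodograph.pressure_eq p.1 p.2 (hsub hp)
      simp only [Function.comp_apply, carrierGreenspan, this, Pi.add_apply]
      ring))
  have hVeq := (hV.hasFDerivAt.comp (x, t) hCG).unique
    (hu'.congr_of_eventuallyEq (by
      filter_upwards [hnhds] with p hp
      exact h.hodograph.velocity_eq p.1 p.2 (hsub hp)))
  have hdet := h.invertible.jacobian_ne_zero x t hp
  have hmass := h.wave.mass x t hp
  have hmom := h.wave.momentum x t hp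
  have hφ : φ (carrierGreenspan η u (x, t)).1 (carrierGreenspan η u (x, t)).2 = u x t :=
    h.hodograph.velocity_eq x t (hsub hp)
  rw [Matrix.det_fin_two_of, ((hasDerivAt_id' x).fun_add hηx).deriv, (hηt.const_add x).deriv,
    (hux.const_sub t).deriv, ((hasDerivAt_id' t).fun_sub hut).deriv] at hdet
  rw [hηt.deriv, ((hasDerivAt_id' x).fun_add hηx).deriv, hux.deriv] at hmass
  rw [hηx.deriv, hut.deriv, hux.deriv] at hmom
  have hsplit : ∀ (L : ℝ × ℝ →L[ℝ] ℝ) (a b : ℝ), L (a, b) = L (1, 0) * a + L (0, 1) * b := by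
    intro L a b
    have : ((a, b) : ℝ × ℝ) = a • (1, 0) + b • (0, 1) := by simp
    rw [this, map_add, map_smul, map_smul, smul_eq_mul, smul_eq_mul]
    ring
  have hPx := DFunLike.congr_fun hPeq (1, 0)
  have hPt := DFunLike.congr_fun hPeq (0, 1)
  have hVx := DFunLike.congr_fun hVeq (1, 0)
  have hVt := DFunLike.congr_fun hVeq (0, 1)
  simp only [ContinuousLinearMap.comp_apply, ContinuousLinearMap.prod_apply,
    add_apply, sub_apply, smul_apply,
    ContinuousLinearMap.coe_fst', ContinuousLinearMap.coe_snd', smul_eq_mul, nsmul_eq_mul]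
    at hPx hPt hVx hVt
  rw [hsplit] at hPx hPt hVx hVt
  rw [hφ]
  refine hodograph_system_of_shallow_water rfl (fun h0 => hdet ?_) hmass hmom ?_ ?_ ?_ ?_
  · linear_combination h0
  · linear_combination hVx
  · linear_combination hVt
  · simp at hPx
    linear_combination hPx
  · simp at hPt
    linear_combination hPt

theorem isHodographSolution (h : IsNonbreakingWave m J R η u ψ φ) :
    IsHodographSolution (m / (m + 1)) (fun q => ψ q.1 q.2) (fun q => φ q.1 q.2) := by
  have hopen : IsOpen {q : ℝ × ℝ | 0 < q.1} := isOpen_lt continuous_const continuous_fst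
  have hP : ∀ q : ℝ × ℝ, 0 < q.1 → DifferentiableAt ℝ (fun q : ℝ × ℝ => ψ q.1 q.2) q := fun q hq =>
    (h.hodograph.contDiffOn_pressure.contDiffAt (hopen.mem_nhds hq)).differentiableAt one_ne_zero
  have hV : ∀ q : ℝ × ℝ, 0 < q.1 → DifferentiableAt ℝ (fun q : ℝ × ℝ => φ q.1 q.2) q := fun q hq =>
    (h.hodograph.contDiffOn_velocity.contDiffAt (hopen.mem_nhds hq)).differentiableAt one_ne_zero
  have hsys : ∀ q : ℝ × ℝ, 0 < q.1 →
      fderiv ℝ (fun q : ℝ × ℝ => ψ q.1 q.2) q (0, 1)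
        + m / (m + 1) * q.1 * fderiv ℝ (fun q : ℝ × ℝ => φ q.1 q.2) q (1, 0) + φ q.1 q.2 = 0 ∧
      fderiv ℝ (fun q : ℝ × ℝ => φ q.1 q.2) q (0, 1)
        + fderiv ℝ (fun q : ℝ × ℝ => ψ q.1 q.2) q (1, 0) = 0 := by
    intro q hq
    by_cases hmem : q ∈ carrierGreenspan η u '' wetInterior J R
    · obtain ⟨⟨x, t⟩, hp, hpq⟩ := hmem
      exact h.hodograph_system_of_mem_image hp hpq (hP q hq) (hV q hq)
    · have h1 := h.hodograph.continuation_mass q.1 q.2 hq hmem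
      have h2 := h.hodograph.continuation_momentum q.1 q.2 hq hmem
      rw [(hP q hq).hasFDerivAt.hasDerivAt_mk_right.deriv,
        (hV q hq).hasFDerivAt.hasDerivAt_mk_left.deriv] at h1
      rw [(hV q hq).hasFDerivAt.hasDerivAt_mk_right.deriv,
        (hP q hq).hasFDerivAt.hasDerivAt_mk_left.deriv] at h2
      exact ⟨h1, h2⟩
  exact ⟨h.hodograph.continuousOn_pressure, h.hodograph.continuousOn_velocity, hP, hV,
    fun q hq => (hsys q hq).1, fun q hq => (hsys q hq).2⟩

theorem shorelineTime_add_deriv (h : IsNonbreakingWave m J R η u ψ φ) (τ : ℝ) :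
    shorelineTime R τ + deriv R (shorelineTime R τ) = τ :=
  Function.invFun_eq (h.invertible.shoreline_bijective.surjective τ)

/-- At a physical time the shoreline `x = -R t` has `σ = 0` and `τ = t + R' t`; at other times the
value is assumed. -/
theorem hodograph_shoreline (h : IsNonbreakingWave m J R η u ψ φ) (t : ℝ) :
    ψ 0 (t + deriv R t) = R t + deriv R t ^ 2 / 2 := by
  by_cases ht : t ∈ J
  · have := h.hodograph.pressure_eq (-R t) t ⟨ht, le_rfl⟩
    rw [h.wave.shoreline_displacement t ht, h.wave.shoreline_velocity t ht] at this
    simpa using this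
  · exact h.hodograph.continuation_shoreline t ht

theorem hodograph_eq_shorelinePressure (h : IsNonbreakingWave m J R η u ψ φ) (τ : ℝ) :
    ψ 0 τ = shorelinePressure R τ := by
  have := h.hodograph_shoreline (shorelineTime R τ)
  rwa [h.shorelineTime_add_deriv] at this

end IsNonbreakingWave

/-- The shoreline value `ψ(0, ·)` of the hodograph pressure is `R t + (R' t)² / 2` with
`t = τ - R' t`; its even component depends only on the initial pressure, and its odd
component depends only on the initial velocity. -/
theorem proposition2 (m : ℝ) (hm : 0 < m) :
    (∀ (J : Set ℝ) (R : ℝ → ℝ) (η u ψ φ : ℝ → ℝ → ℝ), IsNonbreakingWave m J R η u ψ φ →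
      ∀ τ : ℝ, shorelineTime R τ = τ - deriv R (shorelineTime R τ) ∧
        ψ 0 τ = shorelinePressure R τ) ∧
    (∀ (J₁ J₂ : Set ℝ) (R₁ R₂ : ℝ → ℝ) (η₁ u₁ ψ₁ φ₁ η₂ u₂ ψ₂ φ₂ : ℝ → ℝ → ℝ),
      IsNonbreakingWave m J₁ R₁ η₁ u₁ ψ₁ φ₁ →
      IsNonbreakingWave m J₂ R₂ η₂ u₂ ψ₂ φ₂ →
      (Set.EqOn (initialPressure ψ₁) (initialPressure ψ₂) (Set.Ici 0) →
        evenComponent (shorelinePressure R₁) = evenComponent (shorelinePressure R₂)) ∧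
      (Set.EqOn (initialVelocity φ₁) (initialVelocity φ₂) (Set.Ici 0) →
        oddComponent (shorelinePressure R₁) = oddComponent (shorelinePressure R₂))) := by
  refine ⟨fun J R η u ψ φ h τ => ⟨eq_sub_of_add_eq (h.shorelineTime_add_deriv τ),
    h.hodograph_eq_shorelinePressure τ⟩, fun J₁ J₂ R₁ R₂ η₁ u₁ ψ₁ φ₁ η₂ u₂ ψ₂ φ₂ h₁ h₂ => ?_⟩
  obtain ⟨c, hc, hc1, hcm⟩ : ∃ c : ℝ, 0 < c ∧ c < 1 ∧ m / (m + 1) = c ^ 2 := by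
    have hpos : 0 < m / (m + 1) := by positivity
    refine ⟨√(m / (m + 1)), Real.sqrt_pos.2 hpos, ?_, (Real.sq_sqrt hpos.le).symm⟩
    rw [Real.sqrt_lt' one_pos, one_pow, div_lt_one (by positivity)]
    linarith
  have hsol := h₁.isHodographSolution.sub h₂.isHodographSolution
  rw [hcm] at hsol
  refine ⟨fun hψ => funext fun τ => ?_, fun hφ => funext fun τ => ?_⟩
  · have := hsol.pressure_add_neg_eq_zero hc hc1 (fun σ hσ => sub_eq_zero.2 (hψ hσ)) τ
    simp only [h₁.hodograph_eq_shorelinePressure, h₂.hodograph_eq_shorelinePressure] at this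
    simp only [evenComponent]
    linarith
  · have := hsol.pressure_sub_neg_eq_zero hc hc1 (fun σ hσ => sub_eq_zero.2 (hφ hσ)) τ
    simp only [h₁.hodograph_eq_shorelinePressure, h₂.hodograph_eq_shorelinePressure] at this
    simp only [oddComponent]
    linarith
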